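/- Let $k$ be an algebraically closed field of characteristic $0$. A fusion category over $k$ is a $k$-linear semisimple abelian rigid monoidal category $\mathcal C$ with bilinear tensor product, finitely many isomorphism classes of simple objects, finite-dimensional morphism spaces and simple unit object $\mathbf 1$. A simple object $X$ is invertible if $X\otimes X^*\cong\mathbf 1$. A fusion subcategory is a full subcategory containing $\mathbf 1$ and closed under tensor products, duals, finite direct sums and direct summands; it is pointed if all its simple objects are invertible. $\mathcal C$ is a generalized near-group fusion category if for any two non-invertible simple objects $X,Y$ there is an invertible simple object $g$ with $g\otimes X\cong Y$. The adjoint subcategory $\mathcal C_{ad}$ is the fusion subcategory generated by the simple objects occurring in $X\otimes X^*$, for $X$ simple. The universal grading group $\mathcal U(\mathcal C)$ is the group generated by symbols $\deg X$, one for each simple object $X$, subject to the relations $\deg X\cdot\deg Y=\deg Z$ whenever $X,Y,Z$ are simple and $Z$ occurs in $X\otimes Y$ (so $\deg X$ depends only on the isomorphism class of $X$); the component $\mathcal C_g$, for $g\in\mathcal U(\mathcal C)$, is the full subcategory of objects all of whose simple constituents have degree $g$. **Proposition.** Let $\mathcal C$ be a generalized near-group fusion category over $k$, let $X_1,\dots,X_n$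 ($n\ge1$) be a full list of pairwise non-isomorphic representatives of the non-invertible simple objects of $\mathcal C$, and let $k_i=\dim_k\operatorname{Hom}(X_i,X_1\otimes X_1^*)$ for $1\le i\le n$. Assume $(k_1,\dots,k_n)\neq(0,\dots,0)$. Then: (1) The adjoint subcategory $\mathcal C_{ad}$ is non-pointed. The map $\mathcal D\mapsto\{g\in\mathcal U(\mathcal C):\mathcal C_g\cap\mathcal D\neq0\}$ is a bijection from the set of non-pointed fusion subcategories of $\mathcal C$ onto the set of subgroups of $\mathcal U(\mathcal C)$. (2) For every $g\in\mathcal U(\mathcal C)$ the component $\mathcal C_g$ contains an invertible simple object. Moreover, for every $g\in\mathcal U(\mathcal C)$, every invertible simple object $\delta\in\mathcal C_g$ and every full list $A_1,\dots,A_s$ of pairwise non-isomorphic representatives of the simple objects of $\mathcal C_{ad}$, the objects $\delta\otimes A_1,\dots,\delta\otimes A_s$ form a full list of pairwise non-isomorphic representatives of the simple objects of $\mathcal C_g$. -/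

import Mathlib

open CategoryTheory MonoidalCategory Limits

namespace FusionCat

universe v u w

attribute [local instance] Abelian.hasFiniteBiproducts

/-- A fusion category over `k`: a `k`-linear abelian rigid monoidal category with bilinear tensor
product, such that every object is a finite direct sum of simple objects, there are finitely many
isomorphism classes of simple objects, morphism spaces are finite dimensional, and the unit object
is simple. -/
class IsFusionCategory (k : Type w) [Field k] (C : Type u) [Category.{v} C] [Abelian C]
    [Linear k C] [MonoidalCategory C] [MonoidalPreadditive C] [MonoidalLinear k C]
    [RigidCategory C] : Prop where
  simple_unit : Simple (𝟙_ C)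
  finite_hom (X Y : C) : Module.Finite k (X ⟶ Y)
  semisimple (X : C) : ∃ (n : ℕ) (S : Fin n → C), (∀ i, Simple (S i)) ∧ Nonempty (X ≅ ⨁ S)
  finite_simples : ∃ (n : ℕ) (S : Fin n → C), ∀ X : C, Simple X → ∃ i, Nonempty (X ≅ S i)

variable {C : Type u} [Category.{v} C] [Abelian C] [MonoidalCategory C]

/-- `X` is invertible if `X ⊗ X* ≅ 𝟙`. The dual `X*`, with evaluation `X* ⊗ X ⟶ 𝟙` and
coevaluation `𝟙 ⟶ X ⊗ X*`, is called the right dual in Mathlib. -/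
def IsInvertible [RigidCategory C] (X : C) : Prop := Nonempty (X ⊗ Xᘁ ≅ 𝟙_ C)

/-- `Z` occurs in `X`; when `Z` is simple and `X` is semisimple this says that `Z` is isomorphic
to a direct summand of `X`. -/
def Occurs (Z X : C) : Prop := ∃ f : Z ⟶ X, f ≠ 0

/-- `X 0, …, X (s - 1)` is a full list, without repetition up to isomorphism, of the simple
objects satisfying `P`. -/
structure IsIrrList (P : ObjectProperty C) {s : ℕ} (X : Fin s → C) : Prop where
  simple (i : Fin s) : Simple (X i)
  mem (i : Fin s) : P (X i)
  injective (i j : Fin s) : Nonempty (X i ≅ X j) → i = j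
  exhaustive (Y : C) : Simple Y → P Y → ∃ i, Nonempty (Y ≅ X i)

/-- The invertible simple objects act transitively by left tensor multiplication on the isomorphism
classes of non-invertible simple objects. -/
def IsGeneralizedNearGroup (C : Type u) [Category.{v} C] [Abelian C] [MonoidalCategory C]
    [RigidCategory C] : Prop :=
  ∀ X Y : C, Simple X → ¬ IsInvertible X → Simple Y → ¬ IsInvertible Y →
    ∃ g : C, Simple g ∧ IsInvertible g ∧ Nonempty (g ⊗ X ≅ Y)

/-- The multiplicities `dim Hom(X i, X 0 ⊗ (X 0)*)`. When `X` is a full list of the non-invertible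
simple objects, these are the numbers `k₁, …, kₙ` in the type of a generalized near-group fusion
category. -/
noncomputable def multiplicity (k : Type w) [Field k] [Linear k C] [RigidCategory C] {n : ℕ}
    (X : Fin (n + 1) → C) (i : Fin (n + 1)) : ℕ :=
  Module.finrank k (X i ⟶ X 0 ⊗ (X 0)ᘁ)

/-- A fusion subcategory: a full subcategory containing the unit object and closed under tensor
products, duals, finite direct sums and direct summands (in particular under isomorphisms). -/
@[ext]
structure FusionSubcategory (C : Type u) [Category.{v} C] [Abelian C] [MonoidalCategory C]
    [RigidCategory C] where
  obj : ObjectProperty C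
  unit : obj (𝟙_ C)
  tensor {X Y : C} : obj X → obj Y → obj (X ⊗ Y)
  rightDual {X : C} : obj X → obj (Xᘁ)
  leftDual {X : C} : obj X → obj (ᘁX)
  biprod {X Y : C} : obj X → obj Y → obj (X ⊞ Y)
  retract {X Y : C} : Retract X Y → obj Y → obj X

/-- A fusion subcategory is non-pointed if one of its simple objects is not invertible. (Being full
and closed under direct summands, it has the simple objects of `C` that belong to it as its simple
objects.) -/
def FusionSubcategory.IsNonPointed [RigidCategory C] (D : FusionSubcategory C) : Prop :=
  ∃ X : C, Simple X ∧ D.obj X ∧ ¬ IsInvertible X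

/-- The smallest fusion subcategory whose objects include those satisfying `P`. -/
def FusionSubcategory.generatedBy [RigidCategory C] (P : ObjectProperty C) :
    FusionSubcategory C where
  obj A := ∀ D : FusionSubcategory C, P ≤ D.obj → D.obj A
  unit D _ := D.unit
  tensor hX hY D h := D.tensor (hX D h) (hY D h)
  rightDual hX D h := D.rightDual (hX D h)
  leftDual hX D h := D.leftDual (hX D h)
  biprod hX hY D h := D.biprod (hX D h) (hY D h)
  retract r hY D h := D.retract r (hY D h)

/-- The adjoint subcategory, generated by the simple objects occurring in `X ⊗ X*` for simple
`X`. -/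
def adjointSubcategory (C : Type u) [Category.{v} C] [Abelian C] [MonoidalCategory C]
    [RigidCategory C] : FusionSubcategory C :=
  FusionSubcategory.generatedBy fun Y => Simple Y ∧ ∃ X : C, Simple X ∧ Occurs Y (X ⊗ Xᘁ)

/-- The relations `[X] [Y] = [Z]` for simple objects such that `Z` occurs in `X ⊗ Y`. -/
def gradingRelations (C : Type u) [Category.{v} C] [Abelian C] [MonoidalCategory C] :
    Set (FreeGroup {X : C // Simple X}) :=
  {r | ∃ X Y Z : {X : C // Simple X}, Occurs Z.1 (X.1 ⊗ Y.1) ∧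
    r = FreeGroup.of X * FreeGroup.of Y * (FreeGroup.of Z)⁻¹}

/-- The universal grading group: the universal group receiving a degree function on simple objects
for which every simple object occurring in `X ⊗ Y` has degree `deg X * deg Y`. Since `X` and every
object isomorphic to it occur in `X ⊗ 𝟙`, isomorphic simple objects have the same degree. -/
abbrev UniversalGradingGroup (C : Type u) [Category.{v} C] [Abelian C] [MonoidalCategory C] :
    Type u :=
  PresentedGroup (gradingRelations C)

/-- The degree of a simple object in the universal grading. -/
def degree (X : C) (hX : Simple X) : UniversalGradingGroup C :=
  PresentedGroup.of ⟨X, hX⟩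

/-- The component `C_g` of the universal grading: the objects all of whose simple constituents have
degree `g`. -/
def component (g : UniversalGradingGroup C) : ObjectProperty C :=
  fun X => ∀ (Z : C) (hZ : Simple Z), Occurs Z X → degree Z hZ = g

end FusionCat

open FusionCat

/-!
The proof works with the monoid of isomorphism classes of objects under the tensor product
(`Skeleton C`); its units are the classes of the invertible objects (`isInvertible_iff_isUnit`),
which are automatically simple.

The assumption on the multiplicities says that some non-invertible simple object occurs in
`X ⊗ X*`, so that the adjoint subcategory `A` is non-pointed. Conversely every non-pointed fusion
subcategory `D` contains `A` (`adjointSubcategory_le`): if `X` is a non-invertible simple object of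
`D` and `Y` any non-invertible simple object, then `Y* ≅ g ⊗ X` with `g` invertible, and
`Y ⊗ Y* ≅ X* ⊗ X`. In particular `A` is contained in all its conjugates by invertible objects
(`adjointSubcategory_mem_conj`).

Since all non-invertible simple objects are of the form `g ⊗ X` with `X` in `A` fixed, every simple
object lies in a coset `g ⊗ A` with `g` invertible. These cosets multiply like the quotient of the
group of invertible objects by its normal subgroup of invertible objects of `A`, so they are the
components of a grading with trivial component `A`. The universal grading group maps to that
quotient, and therefore a simple object of degree `1` belongs to `A` (`degree_eq_one_iff`).

The correspondence with subgroups is now formal. A subgroup `H` gives the subcategory of objects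
whose constituents have degree in `H`, and if `Z` has the same degree as an object `Y` of a
non-pointed `D`, then `Z ⊗ Y*` lies in `A`, hence in `D`, so that `Z` does too. Likewise each
degree is the degree of some `g ⊗ X` with `X` in `A`, hence of the invertible object `g`, and
tensoring with `g` matches the simple objects of `A` with those of degree `g`.
-/

namespace FusionCat

universe v u w

attribute [local instance] Abelian.hasFiniteBiproducts

/-! ### Simple constituents -/

section Occurs

variable {C : Type u} [Category.{v} C] [Abelian C]

theorem Occurs.of_iso {Z X Y : C} (h : Occurs Z X) (e : X ≅ Y) : Occurs Z Y := by
  obtain ⟨f, hf⟩ := h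
  exact ⟨f ≫ e.hom, fun h0 => hf (by simpa using h0)⟩

theorem Occurs.of_iso_left {Z W X : C} (h : Occurs Z X) (e : Z ≅ W) : Occurs W X := by
  obtain ⟨f, hf⟩ := h
  exact ⟨e.inv ≫ f, fun h0 => hf (by simpa using h0)⟩

theorem Occurs.of_retract {Z X Y : C} (h : Occurs Z X) (r : Retract X Y) : Occurs Z Y := by
  obtain ⟨f, hf⟩ := h
  refine ⟨f ≫ r.i, fun h0 => hf ?_⟩
  have := congrArg (· ≫ r.r) h0
  simpa using this

theorem occurs_refl (Z : C) [Simple Z] : Occurs Z Z := ⟨𝟙 Z, id_nonzero Z⟩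

theorem occurs_of_iso {Z X : C} [Simple Z] (e : Z ≅ X) : Occurs Z X := (occurs_refl Z).of_iso e

theorem Occurs.nonempty_iso {Z X : C} [Simple Z] [Simple X] (h : Occurs Z X) :
    Nonempty (Z ≅ X) := by
  obtain ⟨f, hf⟩ := h
  have := isIso_of_hom_simple hf
  exact ⟨asIso f⟩

theorem Occurs.biprod {Z X Y : C} (h : Occurs Z (X ⊞ Y)) : Occurs Z X ∨ Occurs Z Y := by
  obtain ⟨f, hf⟩ := h
  by_contra! hc
  refine hf (biprod.hom_ext _ _ ?_ ?_)
  · by_contra h0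
    exact hc.1 ⟨_, fun h => h0 (by simpa using h)⟩
  · by_contra h0
    exact hc.2 ⟨_, fun h => h0 (by simpa using h)⟩

end Occurs

variable {C : Type u} [Category.{v} C] [Abelian C] [MonoidalCategory C]

/-! ### Frobenius reciprocity -/

section Reciprocity

variable [MonoidalPreadditive C]

theorem tensorLeftHomEquiv_ne_zero_iff {X Y Y' Z : C} [ExactPairing Y Y'] (f : Y' ⊗ X ⟶ Z) :
    tensorLeftHomEquiv X Y Y' Z f ≠ 0 ↔ f ≠ 0 := by
  have h0 : tensorLeftHomEquiv X Y Y' Z 0 = 0 := by simp [tensorLeftHomEquiv]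
  rw [← h0, (tensorLeftHomEquiv X Y Y' Z).injective.ne_iff]

theorem tensorRightHomEquiv_ne_zero_iff {X Y Y' Z : C} [ExactPairing Y Y'] (f : X ⊗ Y ⟶ Z) :
    tensorRightHomEquiv X Y Y' Z f ≠ 0 ↔ f ≠ 0 := by
  have h0 : tensorRightHomEquiv X Y Y' Z 0 = 0 := by simp [tensorRightHomEquiv]
  rw [← h0, (tensorRightHomEquiv X Y Y' Z).injective.ne_iff]

variable [RigidCategory C]

/-- `Hom(X ⊗ Y, Z) ≠ 0` if and only if `Hom(X, Z ⊗ Y*) ≠ 0`. -/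
theorem occurs_tensor_left_iff {X Y Z : C} : Occurs (X ⊗ Y) Z ↔ Occurs X (Z ⊗ Yᘁ) := by
  constructor
  · rintro ⟨f, hf⟩
    exact ⟨_, tensorRightHomEquiv_ne_zero_iff (Y := Y) (Y' := Yᘁ) f |>.2 hf⟩
  · rintro ⟨f, hf⟩
    obtain ⟨f, rfl⟩ := (tensorRightHomEquiv X Y Yᘁ Z).surjective f
    exact ⟨f, (tensorRightHomEquiv_ne_zero_iff f).1 hf⟩

theorem occurs_tensor_right_iff {X Y Z : C} : Occurs (Y ⊗ X) Z ↔ Occurs X ((ᘁY) ⊗ Z) := by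
  constructor
  · rintro ⟨f, hf⟩
    exact ⟨_, tensorLeftHomEquiv_ne_zero_iff (Y := (ᘁY)) (Y' := Y) f |>.2 hf⟩
  · rintro ⟨f, hf⟩
    obtain ⟨f, rfl⟩ := (tensorLeftHomEquiv X (ᘁY) Y Z).surjective f
    exact ⟨f, (tensorLeftHomEquiv_ne_zero_iff f).1 hf⟩

theorem unit_occurs_tensor_rightDual {X : C} (hX : ¬ IsZero X) : Occurs (𝟙_ C) (X ⊗ Xᘁ) := by
  rw [← occurs_tensor_left_iff]
  refine ⟨(λ_ X).hom, fun h0 => hX ((IsZero.iff_id_eq_zero X).2 ?_)⟩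
  rw [← (λ_ X).inv_hom_id, h0, comp_zero]

theorem unit_occurs_leftDual_tensor {X : C} (hX : ¬ IsZero X) : Occurs (𝟙_ C) ((ᘁX) ⊗ X) := by
  rw [← occurs_tensor_right_iff]
  refine ⟨(ρ_ X).hom, fun h0 => hX ((IsZero.iff_id_eq_zero X).2 ?_)⟩
  rw [← (ρ_ X).inv_hom_id, h0, comp_zero]

theorem not_isZero_rightDual {X : C} (hX : ¬ IsZero X) : ¬ IsZero Xᘁ := fun h0 => by
  obtain ⟨f, hf⟩ := unit_occurs_tensor_rightDual hX
  refine hf (IsZero.eq_of_tgt ?_ _ _)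
  rw [IsZero.iff_id_eq_zero, ← whiskerLeft_id, (IsZero.iff_id_eq_zero _).1 h0]
  simp

theorem not_isZero_leftDual {X : C} (hX : ¬ IsZero X) : ¬ IsZero (ᘁX) := fun h0 => by
  obtain ⟨f, hf⟩ := unit_occurs_leftDual_tensor hX
  refine hf (IsZero.eq_of_tgt ?_ _ _)
  rw [IsZero.iff_id_eq_zero, ← id_whiskerRight, (IsZero.iff_id_eq_zero _).1 h0]
  simp

end Reciprocity

/-! ### Semisimple tensor categories -/

section Semisimple

/-- The part of the definition of a fusion category that does not refer to the ground field: the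
unit object is simple and every object is a finite direct sum of simple objects. -/
class IsSemisimpleTensor (C : Type u) [Category.{v} C] [Abelian C] [MonoidalCategory C] :
    Prop where
  simple_unit : Simple (𝟙_ C)
  semisimple (X : C) : ∃ (n : ℕ) (S : Fin n → C), (∀ i, Simple (S i)) ∧ Nonempty (X ≅ ⨁ S)

attribute [instance] IsSemisimpleTensor.simple_unit

theorem IsFusionCategory.isSemisimpleTensor (k : Type w) [Field k] [Linear k C]
    [MonoidalPreadditive C] [MonoidalLinear k C] [RigidCategory C] [h : IsFusionCategory k C] :
    IsSemisimpleTensor C :=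
  ⟨h.simple_unit, h.semisimple⟩

variable [IsSemisimpleTensor C]

/-- The identity of every object factors through simple objects, summand by summand. -/
theorem exists_sum_comp_eq_id (X : C) :
    ∃ (n : ℕ) (S : Fin n → C) (p : ∀ j, X ⟶ S j) (i : ∀ j, S j ⟶ X),
      (∀ j, Simple (S j)) ∧ ∑ j, p j ≫ i j = 𝟙 X := by
  obtain ⟨n, S, hS, ⟨e⟩⟩ := IsSemisimpleTensor.semisimple X
  refine ⟨n, S, fun j => e.hom ≫ biproduct.π S j, fun j => biproduct.ι S j ≫ e.inv, hS, ?_⟩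
  simp only [Category.assoc, ← Preadditive.comp_sum]
  simp only [← Category.assoc, ← Preadditive.sum_comp]
  simp

theorem Occurs.nonempty_retract {Z X : C} [Simple Z] (h : Occurs Z X) :
    Nonempty (Retract Z X) := by
  obtain ⟨f, hf⟩ := h
  obtain ⟨n, S, p, i, hS, hsum⟩ := exists_sum_comp_eq_id X
  have : ∃ j, f ≫ p j ≠ 0 := by
    by_contra! hc
    apply hf
    rw [← Category.comp_id f, ← hsum, Preadditive.comp_sum]
    exact Finset.sum_eq_zero fun j _ => by rw [← Category.assoc, hc, zero_comp]
  obtain ⟨j, hj⟩ := this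
  have := hS j
  have := isIso_of_hom_simple hj
  exact ⟨⟨f, p j ≫ inv (f ≫ p j), by
    simpa only [Category.assoc] using IsIso.hom_inv_id (f ≫ p j)⟩⟩

/-- In a semisimple category a simple quotient is also a subobject. -/
theorem occurs_of_hom_ne_zero {Z X : C} [Simple Z] (f : X ⟶ Z) (hf : f ≠ 0) : Occurs Z X := by
  obtain ⟨n, S, p, i, hS, hsum⟩ := exists_sum_comp_eq_id X
  have : ∃ j, i j ≫ f ≠ 0 := by
    by_contra! hc
    apply hf
    rw [← Category.id_comp f, ← hsum, Preadditive.sum_comp]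
    exact Finset.sum_eq_zero fun j _ => by rw [Category.assoc, hc, comp_zero]
  obtain ⟨j, hj⟩ := this
  have := hS j
  have := isIso_of_hom_simple hj
  refine ⟨inv (i j ≫ f) ≫ i j, fun h0 => id_nonzero Z ?_⟩
  rw [← IsIso.inv_hom_id (i j ≫ f), ← Category.assoc, h0, zero_comp]

theorem exists_occurs {X : C} (h : ¬ IsZero X) : ∃ Z : C, Simple Z ∧ Occurs Z X := by
  obtain ⟨n, S, p, i, hS, hsum⟩ := exists_sum_comp_eq_id X
  have : ∃ j, i j ≠ 0 := by
    by_contra! hc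
    refine h ((IsZero.iff_id_eq_zero X).2 ?_)
    rw [← hsum]
    exact Finset.sum_eq_zero fun j _ => by rw [hc, comp_zero]
  obtain ⟨j, hj⟩ := this
  exact ⟨S j, hS j, i j, hj⟩

variable [MonoidalPreadditive C]

/-- A constituent of `A ⊗ B` is a constituent of `A ⊗ B'` for some simple constituent `B'` of
`B`. -/
theorem Occurs.exists_right {Z A B : C} (h : Occurs Z (A ⊗ B)) :
    ∃ B' : C, Simple B' ∧ Occurs B' B ∧ Occurs Z (A ⊗ B') := by
  obtain ⟨f, hf⟩ := h
  obtain ⟨n, S, p, i, hS, hsum⟩ := exists_sum_comp_eq_id B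
  have : ∃ j, f ≫ A ◁ p j ≠ 0 := by
    by_contra! hc
    apply hf
    rw [← Category.comp_id f, ← whiskerLeft_id, ← hsum, whiskerLeft_sum, Preadditive.comp_sum]
    exact Finset.sum_eq_zero fun j _ => by
      rw [MonoidalCategory.whiskerLeft_comp, ← Category.assoc, hc, zero_comp]
  obtain ⟨j, hj⟩ := this
  have := hS j
  refine ⟨S j, hS j, occurs_of_hom_ne_zero (p j) fun h0 => hj ?_, _, hj⟩
  rw [h0, MonoidalPreadditive.whiskerLeft_zero, comp_zero]

theorem Occurs.exists_left {Z A B : C} (h : Occurs Z (A ⊗ B)) :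
    ∃ A' : C, Simple A' ∧ Occurs A' A ∧ Occurs Z (A' ⊗ B) := by
  obtain ⟨f, hf⟩ := h
  obtain ⟨n, S, p, i, hS, hsum⟩ := exists_sum_comp_eq_id A
  have : ∃ j, f ≫ p j ▷ B ≠ 0 := by
    by_contra! hc
    apply hf
    rw [← Category.comp_id f, ← id_whiskerRight, ← hsum, sum_whiskerRight, Preadditive.comp_sum]
    exact Finset.sum_eq_zero fun j _ => by
      rw [MonoidalCategory.comp_whiskerRight, ← Category.assoc, hc, zero_comp]
  obtain ⟨j, hj⟩ := this
  have := hS j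
  refine ⟨S j, hS j, occurs_of_hom_ne_zero (p j) fun h0 => hj ?_, _, hj⟩
  rw [h0, MonoidalPreadditive.zero_whiskerRight, comp_zero]

/-! ### Duality -/

variable [RigidCategory C]

/-- `X` maps nontrivially to the right dual of `Y` if and only if `1` is a constituent of
`X ⊗ Y`. -/
theorem occurs_rightDual_iff {X Y : C} : Occurs X Yᘁ ↔ Occurs (𝟙_ C) (X ⊗ Y) := by
  have h : Occurs X Yᘁ ↔ Occurs (X ⊗ Y) (𝟙_ C) := by
    rw [occurs_tensor_left_iff]
    exact ⟨fun h => h.of_iso (λ_ _).symm, fun h => h.of_iso (λ_ _)⟩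
  rw [h]
  constructor
  · rintro ⟨f, hf⟩
    exact occurs_of_hom_ne_zero f hf
  · intro h
    obtain ⟨r⟩ := h.nonempty_retract
    refine ⟨r.r, fun h0 => id_nonzero (𝟙_ C) ?_⟩
    rw [← r.retract, h0, comp_zero]

theorem occurs_leftDual_iff {X Y : C} : Occurs X (ᘁY) ↔ Occurs (𝟙_ C) (Y ⊗ X) := by
  have h : Occurs X (ᘁY) ↔ Occurs (Y ⊗ X) (𝟙_ C) := by
    rw [occurs_tensor_right_iff]
    exact ⟨fun h => h.of_iso (ρ_ _).symm, fun h => h.of_iso (ρ_ _)⟩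
  rw [h]
  constructor
  · rintro ⟨f, hf⟩
    exact occurs_of_hom_ne_zero f hf
  · intro h
    obtain ⟨r⟩ := h.nonempty_retract
    refine ⟨r.r, fun h0 => id_nonzero (𝟙_ C) ?_⟩
    rw [← r.retract, h0, comp_zero]

/-- Tensoring with a nonzero object `X` is faithful, since `1` is a direct summand of `ᘁX ⊗ X`. -/
theorem whiskerLeft_ne_zero {X A B : C} (hX : ¬ IsZero X) {f : A ⟶ B} (hf : f ≠ 0) :
    X ◁ f ≠ 0 := by
  intro h0
  obtain ⟨r⟩ := (unit_occurs_leftDual_tensor hX).nonempty_retract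
  have h1 : ((ᘁX) ⊗ X) ◁ f = 0 := by
    rw [MonoidalCategory.tensor_whiskerLeft, h0]; simp
  have h2 : r.i ▷ A ≫ ((ᘁX) ⊗ X) ◁ f ≫ r.r ▷ B = 𝟙_ C ◁ f := by
    rw [← whisker_exchange_assoc, ← comp_whiskerRight, r.retract]; simp
  rw [h1, zero_comp, comp_zero, id_whiskerLeft] at h2
  apply hf
  have := congrArg (fun t => (λ_ A).inv ≫ t ≫ (λ_ B).hom) h2
  simpa using this.symm

theorem whiskerRight_ne_zero {X A B : C} (hX : ¬ IsZero X) {f : A ⟶ B} (hf : f ≠ 0) :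
    f ▷ X ≠ 0 := by
  intro h0
  obtain ⟨r⟩ := (unit_occurs_tensor_rightDual hX).nonempty_retract
  have h1 : f ▷ (X ⊗ Xᘁ) = 0 := by
    rw [MonoidalCategory.whiskerRight_tensor, h0]; simp
  have h2 : A ◁ r.i ≫ f ▷ (X ⊗ Xᘁ) ≫ B ◁ r.r = f ▷ 𝟙_ C := by
    rw [← whisker_exchange, ← MonoidalCategory.whiskerLeft_comp_assoc, r.retract]; simp
  rw [h1, zero_comp, comp_zero, whiskerRight_id] at h2
  apply hf
  have := congrArg (fun t => (ρ_ A).inv ≫ t ≫ (ρ_ B).hom) h2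
  simpa using this.symm

theorem Occurs.tensorLeft {Z X : C} (h : Occurs Z X) {Y : C} (hY : ¬ IsZero Y) :
    Occurs (Y ⊗ Z) (Y ⊗ X) := by
  obtain ⟨f, hf⟩ := h
  exact ⟨_, whiskerLeft_ne_zero hY hf⟩

theorem Occurs.tensorRight {Z X : C} (h : Occurs Z X) {Y : C} (hY : ¬ IsZero Y) :
    Occurs (Z ⊗ Y) (X ⊗ Y) := by
  obtain ⟨f, hf⟩ := h
  exact ⟨_, whiskerRight_ne_zero hY hf⟩

theorem not_isZero_tensor {X Y : C} (hX : ¬ IsZero X) (hY : ¬ IsZero Y) : ¬ IsZero (X ⊗ Y) := by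
  rw [IsZero.iff_id_eq_zero, ← whiskerLeft_id]
  exact whiskerLeft_ne_zero hX (by rwa [Ne, ← IsZero.iff_id_eq_zero])

/-- Retracts of `X*` dualize to retracts of `X`, so `X*` has no proper constituents. -/
theorem simple_rightDual (X : C) [Simple X] : Simple Xᘁ := by
  obtain ⟨S, hS, hSX⟩ := exists_occurs (not_isZero_rightDual (Simple.not_isZero X))
  obtain ⟨r⟩ := hSX.nonempty_retract
  have hr : (ᘁr.r) ≫ (ᘁr.i) = 𝟙 (ᘁS) := by
    rw [← comp_leftAdjointMate, r.retract, leftAdjointMate_id]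
  -- The left dual of `Xᘁ` is `X` by definition.
  let f : (ᘁS) ⟶ X := (ᘁr.r)
  have hm : Mono f := ⟨fun a b hab => by
    have := congrArg (· ≫ (ᘁr.i)) hab
    simpa [f, hr] using this⟩
  have hf : f ≠ 0 := fun h0 => not_isZero_leftDual (Simple.not_isZero S) <| by
    rw [IsZero.iff_id_eq_zero, ← hr]
    exact (congrArg (· ≫ (ᘁr.i)) h0).trans zero_comp
  have := isIso_of_mono_of_nonzero hf
  have : ExactPairing X S := exactPairingCongrLeft (asIso f).symm
  exact Simple.of_iso (rightDualIso inferInstance this)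

end Semisimple

/-! ### Invertible objects as units of the monoid of isomorphism classes -/

section Invertible

theorem toSkeleton_out {C : Type u} [Category.{v} C] (a : Skeleton C) :
    toSkeleton (Quotient.out a : C) = a :=
  Quotient.out_eq a

theorem exists_toSkeleton_mul_eq_one {C : Type u} [Category.{v} C]
    [MonoidalCategory C] {U : C} (hU : IsUnit (toSkeleton U)) :
    ∃ V : C, toSkeleton U * toSkeleton V = 1 ∧ toSkeleton V * toSkeleton U = 1 := by
  obtain ⟨u, hu⟩ := hU
  refine ⟨Quotient.out (u⁻¹ : (Skeleton C)ˣ).val, ?_, ?_⟩ <;> rw [toSkeleton_out, ← hu] <;> simp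

variable [IsSemisimpleTensor C] [MonoidalPreadditive C]

theorem not_isZero_of_mul_eq_one {U V : C} (h : toSkeleton U * toSkeleton V = 1) :
    ¬ IsZero V := by
  rw [← Skeleton.toSkeleton_tensorObj, Skeleton.one_eq, toSkeleton_eq_toSkeleton_iff] at h
  obtain ⟨e⟩ := h
  refine fun h0 => Simple.not_isZero (𝟙_ C) (IsZero.of_iso ?_ e.symm)
  rw [IsZero.iff_id_eq_zero, ← whiskerLeft_id, (IsZero.iff_id_eq_zero _).1 h0]
  simp

variable [RigidCategory C]

/-- Tensoring with an invertible object preserves simplicity: a constituent of `U ⊗ X` yields one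
of `X` after tensoring with the inverse of `U`. -/
theorem simple_tensor_of_isUnit {U : C} (hU : IsUnit (toSkeleton U)) (X : C) [Simple X] :
    Simple (U ⊗ X) := by
  obtain ⟨V, hUV, hVU⟩ := exists_toSkeleton_mul_eq_one hU
  have hU0 := not_isZero_of_mul_eq_one hVU
  have hV0 := not_isZero_of_mul_eq_one hUV
  obtain ⟨S, hS, hSX⟩ := exists_occurs (not_isZero_tensor hU0 (Simple.not_isZero X))
  obtain ⟨r⟩ := hSX.nonempty_retract
  have he : toSkeleton (V ⊗ (U ⊗ X)) = toSkeleton X := by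
    simp only [Skeleton.toSkeleton_tensorObj, ← mul_assoc, hVU, one_mul]
  obtain ⟨e⟩ := toSkeleton_eq_toSkeleton_iff.1 he
  let r' : Retract (V ⊗ S) X := (r.map (tensorLeft V)).trans (Retract.ofIso e)
  have hr0 : r'.i ≠ 0 := fun h0 => not_isZero_tensor hV0 (Simple.not_isZero S) <| by
    rw [IsZero.iff_id_eq_zero, ← r'.retract, h0, zero_comp]
  have : Mono r'.i := mono_of_mono_fac r'.retract
  have := isIso_of_mono_of_nonzero hr0
  have hSe : toSkeleton (U ⊗ X) = toSkeleton S := by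
    rw [Skeleton.toSkeleton_tensorObj, ← toSkeleton_eq_toSkeleton_iff.2 ⟨asIso r'.i⟩,
      Skeleton.toSkeleton_tensorObj, ← mul_assoc, hUV, one_mul]
  obtain ⟨e'⟩ := toSkeleton_eq_toSkeleton_iff.1 hSe
  exact Simple.of_iso e'

theorem simple_tensor_of_isUnit' {U : C} (hU : IsUnit (toSkeleton U)) (X : C) [Simple X] :
    Simple (X ⊗ U) := by
  obtain ⟨V, hUV, hVU⟩ := exists_toSkeleton_mul_eq_one hU
  have hU0 := not_isZero_of_mul_eq_one hVU
  have hV0 := not_isZero_of_mul_eq_one hUV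
  obtain ⟨S, hS, hSX⟩ := exists_occurs (not_isZero_tensor (Simple.not_isZero X) hU0)
  obtain ⟨r⟩ := hSX.nonempty_retract
  have he : toSkeleton ((X ⊗ U) ⊗ V) = toSkeleton X := by
    simp only [Skeleton.toSkeleton_tensorObj, mul_assoc, hUV, mul_one]
  obtain ⟨e⟩ := toSkeleton_eq_toSkeleton_iff.1 he
  let r' : Retract (S ⊗ V) X := (r.map (tensorRight V)).trans (Retract.ofIso e)
  have hr0 : r'.i ≠ 0 := fun h0 => not_isZero_tensor (Simple.not_isZero S) hV0 <| by
    rw [IsZero.iff_id_eq_zero, ← r'.retract, h0, zero_comp]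
  have : Mono r'.i := mono_of_mono_fac r'.retract
  have := isIso_of_mono_of_nonzero hr0
  have hSe : toSkeleton (X ⊗ U) = toSkeleton S := by
    rw [Skeleton.toSkeleton_tensorObj, ← toSkeleton_eq_toSkeleton_iff.2 ⟨asIso r'.i⟩,
      Skeleton.toSkeleton_tensorObj, mul_assoc, hVU, mul_one]
  obtain ⟨e'⟩ := toSkeleton_eq_toSkeleton_iff.1 hSe
  exact Simple.of_iso e'

theorem simple_of_isUnit {U : C} (hU : IsUnit (toSkeleton U)) : Simple U :=
  have := simple_tensor_of_isUnit hU (𝟙_ C)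
  Simple.of_iso (ρ_ U).symm

theorem simple_out (u : (Skeleton C)ˣ) : Simple (Quotient.out u.val : C) :=
  simple_of_isUnit (by rw [toSkeleton_out]; exact u.isUnit)

/-- The dual of an invertible object is its inverse. -/
theorem toSkeleton_rightDual_of_mul_eq_one {U V : C} (hUV : toSkeleton U * toSkeleton V = 1)
    (hVU : toSkeleton V * toSkeleton U = 1) : toSkeleton Uᘁ = toSkeleton V := by
  have := simple_of_isUnit (isUnit_iff_exists.2 ⟨_, hUV, hVU⟩)
  have := simple_of_isUnit (isUnit_iff_exists.2 ⟨_, hVU, hUV⟩)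
  have := simple_rightDual U
  rw [← Skeleton.toSkeleton_tensorObj, Skeleton.one_eq, toSkeleton_eq_toSkeleton_iff] at hVU
  obtain ⟨e⟩ := hVU
  obtain ⟨e'⟩ := (occurs_rightDual_iff.2 (occurs_of_iso e.symm)).nonempty_iso
  exact congr_toSkeleton_of_iso e'.symm

/-- If `X ⊗ X* ≅ 1` with `X` simple, then also `X* ⊗ X ≅ 1`: the object `X ⊗ (X* ⊗ X) ≅ X` is
simple, so `X* ⊗ X` cannot be larger than its constituent `1`. -/
theorem isInvertible_iff_isUnit {X : C} [Simple X] :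
    IsInvertible X ↔ IsUnit (toSkeleton X) := by
  constructor
  · rintro ⟨e⟩
    have h1 : toSkeleton X * toSkeleton Xᘁ = 1 := by
      rw [← Skeleton.toSkeleton_tensorObj]
      exact congr_toSkeleton_of_iso e
    have := simple_rightDual X
    obtain ⟨r⟩ := (occurs_rightDual_iff.1 (occurs_refl Xᘁ)).nonempty_retract
    have he : toSkeleton (X ⊗ (Xᘁ ⊗ X)) = toSkeleton X := by
      simp only [Skeleton.toSkeleton_tensorObj, ← mul_assoc, h1, one_mul]
    obtain ⟨e'⟩ := toSkeleton_eq_toSkeleton_iff.1 he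
    have : Simple (X ⊗ (Xᘁ ⊗ X)) := Simple.of_iso e'
    have : Simple (X ⊗ 𝟙_ C) := Simple.of_iso (ρ_ X)
    have hir : X ◁ r.i ≫ X ◁ r.r = 𝟙 _ := by
      rw [← MonoidalCategory.whiskerLeft_comp, r.retract, whiskerLeft_id]
    have : IsIso (X ◁ r.r) := isIso_of_hom_simple fun h0 => id_nonzero (X ⊗ 𝟙_ C) <| by
      rw [← hir, h0, comp_zero]
    have hri : X ◁ r.r ≫ X ◁ r.i = 𝟙 _ := by
      rw [← cancel_mono (X ◁ r.r), Category.assoc, hir]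
      simp
    -- Tensoring with `X` is faithful, so the summand `1` is all of `X* ⊗ X`.
    have h2 : r.r ≫ r.i = 𝟙 (Xᘁ ⊗ X) := by
      by_contra hne
      refine whiskerLeft_ne_zero (Simple.not_isZero X) (sub_ne_zero.2 hne) ?_
      calc X ◁ (r.r ≫ r.i - 𝟙 (Xᘁ ⊗ X)) = X ◁ (r.r ≫ r.i) - X ◁ 𝟙 (Xᘁ ⊗ X) :=
            (tensorLeft X).map_sub
        _ = 0 := by rw [MonoidalCategory.whiskerLeft_comp, hri, whiskerLeft_id, sub_self]
    refine isUnit_iff_exists.2 ⟨_, h1, ?_⟩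
    rw [← Skeleton.toSkeleton_tensorObj]
    exact congr_toSkeleton_of_iso ⟨r.r, r.i, h2, r.retract⟩
  · intro hX
    obtain ⟨V, hUV, hVU⟩ := exists_toSkeleton_mul_eq_one hX
    rw [← toSkeleton_rightDual_of_mul_eq_one hUV hVU, ← Skeleton.toSkeleton_tensorObj] at hUV
    exact toSkeleton_eq_toSkeleton_iff.1 hUV

end Invertible

/-! ### Fusion subcategories -/

namespace FusionSubcategory

variable [RigidCategory C] (D : FusionSubcategory C)

theorem obj_of_iso {X Y : C} (e : X ≅ Y) (h : D.obj X) : D.obj Y :=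
  D.retract (Retract.ofIso e.symm) h

/-- Membership of an isomorphism class of objects in a fusion subcategory. -/
def Mem (a : Skeleton C) : Prop := D.obj (Quotient.out a)

theorem mem_toSkeleton {X : C} : D.Mem (toSkeleton X) ↔ D.obj X :=
  ⟨D.obj_of_iso (fromSkeletonToSkeletonIso X),
    D.obj_of_iso (fromSkeletonToSkeletonIso X).symm⟩

theorem mem_one : D.Mem 1 := D.mem_toSkeleton.2 D.unit

theorem mem_mul {a b : Skeleton C} (ha : D.Mem a) (hb : D.Mem b) : D.Mem (a * b) :=
  D.mem_toSkeleton.2 (D.tensor ha hb)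

theorem obj_of_isZero {X : C} (h : IsZero X) : D.obj X :=
  D.retract ⟨0, 0, h.eq_of_src _ _⟩ D.unit

theorem obj_biproduct : ∀ {n : ℕ} (S : Fin n → C), (∀ j, D.obj (S j)) → D.obj (⨁ S)
  | 0, S, _ => D.obj_of_isZero <| by
      rw [IsZero.iff_id_eq_zero]
      exact biproduct.hom_ext _ _ fun j => j.elim0
  | n + 1, S, h => by
      refine D.retract ⟨biprod.lift (biproduct.π S 0)
          (biproduct.lift fun j : Fin n => biproduct.π S j.succ),
        biprod.desc (biproduct.ι S 0)
          (biproduct.desc fun j : Fin n => biproduct.ι S j.succ), ?_⟩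
        (D.biprod (h 0) (obj_biproduct (fun j => S j.succ) fun j => h j.succ))
      rw [biprod.lift_desc, biproduct.lift_desc, ← biproduct.total, Fin.sum_univ_succ]

variable [IsSemisimpleTensor C]

theorem obj_of_occurs {Z X : C} [Simple Z] (h : Occurs Z X) (hX : D.obj X) : D.obj Z := by
  obtain ⟨r⟩ := h.nonempty_retract
  exact D.retract r hX

/-- A fusion subcategory contains an object as soon as it contains all its simple constituents. -/
theorem obj_of_forall_occurs {X : C} (h : ∀ Z : C, Simple Z → Occurs Z X → D.obj Z) :
    D.obj X := by
  obtain ⟨n, S, hS, ⟨e⟩⟩ := IsSemisimpleTensor.semisimple X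
  refine D.obj_of_iso e.symm (D.obj_biproduct S fun j => h _ (hS j) ?_)
  have := hS j
  refine ⟨biproduct.ι S j ≫ e.inv, fun h0 => id_nonzero (S j) ?_⟩
  have := congrArg (· ≫ e.hom ≫ biproduct.π S j) h0
  simpa using this

end FusionSubcategory

/-! ### The adjoint subcategory of a generalized near-group category -/

section Adjoint

variable [IsSemisimpleTensor C] [MonoidalPreadditive C] [RigidCategory C]

/-- Every non-pointed fusion subcategory of a generalized near-group fusion category contains the
adjoint subcategory. If `X` is a non-invertible simple object of `D` and `Y` is any non-invertible
simple object, then `Y* ≅ g ⊗ X` with `g` invertible, so that `Y ⊗ g ≅ X*` and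
`Y ⊗ Y* ≅ Y ⊗ g ⊗ X ≅ X* ⊗ X`. -/
theorem adjointSubcategory_le (hC : IsGeneralizedNearGroup C) {D : FusionSubcategory C}
    (hD : D.IsNonPointed) : (adjointSubcategory C).obj ≤ D.obj := by
  intro A hA
  refine hA D ?_
  rintro Z ⟨hZ, Y, hY, hZY⟩
  refine D.obj_of_occurs hZY ?_
  by_cases hYinv : IsInvertible Y
  · exact D.obj_of_iso hYinv.some.symm D.unit
  obtain ⟨X, hX, hXD, hXinv⟩ := hD
  have hYd := simple_rightDual Y
  have hXd := simple_rightDual X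
  -- If `Y*` were invertible, `Y ⊗ Y*` would be simple, hence equal to its constituent `1`.
  have hYdinv : ¬ IsInvertible Yᘁ := fun h => hYinv <| by
    have := simple_tensor_of_isUnit' (isInvertible_iff_isUnit.1 h) Y
    obtain ⟨e⟩ := (unit_occurs_tensor_rightDual (Simple.not_isZero Y)).nonempty_iso
    exact ⟨e.symm⟩
  obtain ⟨g, hg, hginv, ⟨e⟩⟩ := hC X Yᘁ hX hXinv hYd hYdinv
  have := simple_tensor_of_isUnit' (isInvertible_iff_isUnit.1 hginv) Y
  have e1 : Y ⊗ Yᘁ ≅ (Y ⊗ g) ⊗ X := whiskerLeftIso Y e.symm ≪≫ (α_ Y g X).symm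
  obtain ⟨e2⟩ := (occurs_rightDual_iff.2
    ((unit_occurs_tensor_rightDual (Simple.not_isZero Y)).of_iso e1)).nonempty_iso
  exact D.obj_of_iso (whiskerRightIso e2.symm X ≪≫ e1.symm) (D.tensor (D.rightDual hXD) hXD)

end Adjoint

/-! ### Conjugating a fusion subcategory by an invertible object -/

section Conj

theorem toSkeleton_conj {C : Type u} [Category.{v} C] [MonoidalCategory C] (u v : Skeleton C)
    (A : C) :
    toSkeleton ((Quotient.out u : C) ⊗ (A ⊗ (Quotient.out v : C))) = u * (toSkeleton A * v) := by
  simp only [Skeleton.toSkeleton_tensorObj, toSkeleton_out]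

variable [IsSemisimpleTensor C] [MonoidalPreadditive C] [RigidCategory C]

theorem toSkeleton_leftDual_of_mul_eq_one {U V : C} (hUV : toSkeleton U * toSkeleton V = 1)
    (hVU : toSkeleton V * toSkeleton U = 1) : toSkeleton (ᘁU) = toSkeleton V := by
  obtain ⟨e⟩ := toSkeleton_eq_toSkeleton_iff.1 (toSkeleton_rightDual_of_mul_eq_one hVU hUV)
  have : ExactPairing V U := exactPairingCongrRight e.symm
  exact congr_toSkeleton_of_iso (leftDualIso inferInstance this)

theorem toSkeleton_rightDual_out (u : (Skeleton C)ˣ) :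
    toSkeleton (Quotient.out u.val : C)ᘁ = (u⁻¹ : (Skeleton C)ˣ).val :=
  (toSkeleton_rightDual_of_mul_eq_one (V := Quotient.out (u⁻¹ : (Skeleton C)ˣ).val)
    (by simp [toSkeleton_out]) (by simp [toSkeleton_out])).trans (toSkeleton_out _)

theorem toSkeleton_leftDual_out (u : (Skeleton C)ˣ) :
    toSkeleton (ᘁ(Quotient.out u.val : C)) = (u⁻¹ : (Skeleton C)ˣ).val :=
  (toSkeleton_leftDual_of_mul_eq_one (V := Quotient.out (u⁻¹ : (Skeleton C)ˣ).val)
    (by simp [toSkeleton_out]) (by simp [toSkeleton_out])).trans (toSkeleton_out _)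

/-- The fusion subcategory of all objects `A` such that `u ⊗ A ⊗ u⁻¹` belongs to `D`. -/
def FusionSubcategory.conj (D : FusionSubcategory C) (u : (Skeleton C)ˣ) :
    FusionSubcategory C where
  obj A := D.obj ((Quotient.out u.val : C) ⊗ (A ⊗ (Quotient.out (u⁻¹ : (Skeleton C)ˣ).val : C)))
  unit := by
    rw [← D.mem_toSkeleton, toSkeleton_conj, ← Skeleton.one_eq, one_mul, Units.mul_inv]
    exact D.mem_one
  tensor {A B} hA hB := by
    rw [← D.mem_toSkeleton, toSkeleton_conj] at hA hB ⊢
    have h : u.val * (toSkeleton (A ⊗ B) * (u⁻¹ : (Skeleton C)ˣ).val) =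
        u.val * (toSkeleton A * (u⁻¹ : (Skeleton C)ˣ).val) *
          (u.val * (toSkeleton B * (u⁻¹ : (Skeleton C)ˣ).val)) := by
      simp [Skeleton.toSkeleton_tensorObj, mul_assoc]
    rw [h]
    exact D.mem_mul hA hB
  rightDual {A} hA := by
    have h := D.rightDual hA
    rw [← D.mem_toSkeleton, congr_toSkeleton_of_iso (rightDualTensorIso _ _),
      Skeleton.toSkeleton_tensorObj, congr_toSkeleton_of_iso (rightDualTensorIso _ _),
      Skeleton.toSkeleton_tensorObj, toSkeleton_rightDual_out, toSkeleton_rightDual_out,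
      inv_inv, mul_assoc] at h
    rwa [← D.mem_toSkeleton, toSkeleton_conj]
  leftDual {A} hA := by
    have h := D.leftDual hA
    rw [← D.mem_toSkeleton, congr_toSkeleton_of_iso (leftDualTensorIso _ _),
      Skeleton.toSkeleton_tensorObj, congr_toSkeleton_of_iso (leftDualTensorIso _ _),
      Skeleton.toSkeleton_tensorObj, toSkeleton_leftDual_out, toSkeleton_leftDual_out,
      inv_inv, mul_assoc] at h
    rwa [← D.mem_toSkeleton, toSkeleton_conj]
  biprod {A B} hA hB :=
    let F := tensorRight (Quotient.out (u⁻¹ : (Skeleton C)ˣ).val : C) ⋙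
      tensorLeft (Quotient.out u.val : C)
    have := preservesBinaryBiproducts_of_preservesBiproducts F
    D.obj_of_iso (F.mapBiprod A B).symm (D.biprod hA hB)
  retract r hB := D.retract
    (r.map (tensorRight (Quotient.out (u⁻¹ : (Skeleton C)ˣ).val : C) ⋙
      tensorLeft (Quotient.out u.val : C))) hB

theorem FusionSubcategory.conj_obj_iff (D : FusionSubcategory C) (u : (Skeleton C)ˣ) (A : C) :
    (D.conj u).obj A ↔ D.Mem (u.val * (toSkeleton A * (u⁻¹ : (Skeleton C)ˣ).val)) := by
  rw [← toSkeleton_conj, D.mem_toSkeleton]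
  rfl

theorem FusionSubcategory.IsNonPointed.conj {D : FusionSubcategory C} (hD : D.IsNonPointed)
    (u : (Skeleton C)ˣ) : (D.conj u).IsNonPointed := by
  obtain ⟨X, hX, hXD, hXinv⟩ := hD
  let X' : C := (Quotient.out (u⁻¹ : (Skeleton C)ˣ).val : C) ⊗ (X ⊗ (Quotient.out u.val : C))
  have hX' : toSkeleton X' = (u⁻¹ : (Skeleton C)ˣ).val * (toSkeleton X * u.val) :=
    toSkeleton_conj _ _ _
  have hu : IsUnit (toSkeleton (Quotient.out u.val : C)) := by
    rw [toSkeleton_out]; exact u.isUnit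
  have hu' : IsUnit (toSkeleton (Quotient.out (u⁻¹ : (Skeleton C)ˣ).val : C)) := by
    rw [toSkeleton_out]; exact (u⁻¹).isUnit
  have := simple_tensor_of_isUnit' hu X
  have hs : Simple X' := simple_tensor_of_isUnit hu' _
  refine ⟨X', hs, ?_, ?_⟩
  · rw [D.conj_obj_iff, hX']
    simpa [mul_assoc, D.mem_toSkeleton] using hXD
  · rw [isInvertible_iff_isUnit] at hXinv ⊢
    rwa [hX', Units.isUnit_units_mul, Units.isUnit_mul_units]

/-- The adjoint subcategory is stable under conjugation by invertible objects, since it is contained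
in all of its conjugates. -/
theorem adjointSubcategory_mem_conj (hC : IsGeneralizedNearGroup C)
    (hA : (adjointSubcategory C).IsNonPointed) (u : (Skeleton C)ˣ) {a : Skeleton C}
    (ha : (adjointSubcategory C).Mem a) :
    (adjointSubcategory C).Mem (u.val * a * (u⁻¹ : (Skeleton C)ˣ).val) := by
  have := ((adjointSubcategory C).conj_obj_iff u _).1 (adjointSubcategory_le hC (hA.conj u) _ ha)
  rwa [toSkeleton_out, ← mul_assoc] at this

/-- The group of isomorphism classes of invertible objects of a fusion subcategory. -/
def FusionSubcategory.invertibles (D : FusionSubcategory C) : Subgroup (Skeleton C)ˣ where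
  carrier := {u | D.Mem u.val}
  one_mem' := D.mem_one
  mul_mem' ha hb := D.mem_mul ha hb
  inv_mem' {u} hu := by
    have h := D.rightDual hu
    rwa [← D.mem_toSkeleton, toSkeleton_rightDual_out] at h

theorem normal_invertibles_adjointSubcategory (hC : IsGeneralizedNearGroup C)
    (hA : (adjointSubcategory C).IsNonPointed) : (adjointSubcategory C).invertibles.Normal :=
  ⟨fun _ hu g => adjointSubcategory_mem_conj hC hA g hu⟩

/-! ### Cosets of a non-pointed fusion subcategory -/

/-- If `D` is non-pointed, every simple object lies in `g ⊗ D` for an invertible object `g`. -/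
theorem exists_mem_inv_mul (hC : IsGeneralizedNearGroup C) {D : FusionSubcategory C}
    (hD : D.IsNonPointed) (Y : C) [hY : Simple Y] :
    ∃ g : (Skeleton C)ˣ, D.Mem ((g⁻¹ : (Skeleton C)ˣ).val * toSkeleton Y) := by
  by_cases hYinv : IsInvertible Y
  · obtain ⟨g, hg⟩ := isInvertible_iff_isUnit.1 hYinv
    refine ⟨g, ?_⟩
    rw [← hg, Units.inv_mul]
    exact D.mem_one
  · obtain ⟨X, hX, hXD, hXinv⟩ := hD
    obtain ⟨g, hg, hginv, ⟨e⟩⟩ := hC X Y hX hXinv hY hYinv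
    obtain ⟨g', hg'⟩ := isInvertible_iff_isUnit.1 hginv
    refine ⟨g', ?_⟩
    rw [← congr_toSkeleton_of_iso e, Skeleton.toSkeleton_tensorObj, ← hg',
      Units.inv_mul_cancel_left]
    exact D.mem_toSkeleton.2 hXD

/-- The coset `g ⊗ D` containing a simple object `Y` determines `g` up to invertible objects of `D`:
from `g⁻¹ ⊗ Y` and `h⁻¹ ⊗ Y` in `D` it follows that `g⁻¹ ⊗ h`, a constituent of
`(g⁻¹ ⊗ Y) ⊗ (h⁻¹ ⊗ Y)*`, is in `D`. -/
theorem inv_mul_mem_invertibles {D : FusionSubcategory C} {Y : C} [Simple Y]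
    {g h : (Skeleton C)ˣ} (hg : D.Mem ((g⁻¹ : (Skeleton C)ˣ).val * toSkeleton Y))
    (hh : D.Mem ((h⁻¹ : (Skeleton C)ˣ).val * toSkeleton Y)) : g⁻¹ * h ∈ D.invertibles := by
  have hW := simple_out (g⁻¹ * h)
  have hU : IsUnit (toSkeleton (Quotient.out (g⁻¹ : (Skeleton C)ˣ).val : C)) := by
    rw [toSkeleton_out]; exact (g⁻¹).isUnit
  have hA := simple_tensor_of_isUnit hU Y
  set A : C := (Quotient.out (g⁻¹ : (Skeleton C)ˣ).val : C) ⊗ Y with hAdef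
  have hA' : toSkeleton A = (g⁻¹ : (Skeleton C)ˣ).val * toSkeleton Y := by
    rw [hAdef, Skeleton.toSkeleton_tensorObj, toSkeleton_out]
  set B : C := Quotient.out ((h⁻¹ : (Skeleton C)ˣ).val * toSkeleton Y) with hBdef
  set W : C := Quotient.out (g⁻¹ * h).val with hWdef
  -- `W ⊗ B ≅ A` with `W = g⁻¹ ⊗ h`, so `W` maps nontrivially to `A ⊗ B*`.
  have hWB : toSkeleton A = toSkeleton (W ⊗ B) := by
    rw [hA', Skeleton.toSkeleton_tensorObj, hBdef, hWdef, toSkeleton_out, toSkeleton_out,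
      Units.val_mul, mul_assoc, Units.mul_inv_cancel_left]
  obtain ⟨e⟩ := toSkeleton_eq_toSkeleton_iff.1 hWB
  have hocc := occurs_tensor_left_iff.1 ((occurs_refl A).of_iso_left e)
  rw [← hA', D.mem_toSkeleton] at hg
  exact D.obj_of_occurs hocc (D.tensor hg (D.rightDual hh))

/-- The cosets `g ⊗ A` of the adjoint subcategory multiply like the invertible objects `g`:
`(g h)⁻¹ ⊗ X ⊗ Y` is the product of `h⁻¹ ⊗ (g⁻¹ ⊗ X) ⊗ h` and `h⁻¹ ⊗ Y`. -/
theorem adjointSubcategory_mem_inv_mul_of_occurs (hC : IsGeneralizedNearGroup C)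
    (hA : (adjointSubcategory C).IsNonPointed) {X Y Z : C} [Simple Z] (hZ : Occurs Z (X ⊗ Y))
    {g h : (Skeleton C)ˣ}
    (hg : (adjointSubcategory C).Mem ((g⁻¹ : (Skeleton C)ˣ).val * toSkeleton X))
    (hh : (adjointSubcategory C).Mem ((h⁻¹ : (Skeleton C)ˣ).val * toSkeleton Y)) :
    (adjointSubcategory C).Mem (((g * h)⁻¹ : (Skeleton C)ˣ).val * toSkeleton Z) := by
  have hU : IsUnit (toSkeleton (Quotient.out ((g * h)⁻¹ : (Skeleton C)ˣ).val : C)) := by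
    rw [toSkeleton_out]; exact ((g * h)⁻¹).isUnit
  have := simple_of_isUnit hU
  have := simple_tensor_of_isUnit hU Z
  have hocc := hZ.tensorLeft (Simple.not_isZero (Quotient.out ((g * h)⁻¹ : (Skeleton C)ˣ).val : C))
  have hmem := (adjointSubcategory C).mem_mul (adjointSubcategory_mem_conj hC hA h⁻¹ hg) hh
  rw [← toSkeleton_out ((g * h)⁻¹ : (Skeleton C)ˣ).val, ← Skeleton.toSkeleton_tensorObj,
    FusionSubcategory.mem_toSkeleton]
  refine (adjointSubcategory C).obj_of_occurs hocc ?_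
  rw [← FusionSubcategory.mem_toSkeleton, Skeleton.toSkeleton_tensorObj, toSkeleton_out,
    Skeleton.toSkeleton_tensorObj]
  simpa [mul_assoc] using hmem

end Conj

/-! ### The universal grading -/

section Degree

theorem degree_eq_mul {X Y Z : C} (hX : Simple X) (hY : Simple Y) (hZ : Simple Z)
    (h : Occurs Z (X ⊗ Y)) : degree Z hZ = degree X hX * degree Y hY :=
  (PresentedGroup.mk_eq_mk_of_mul_inv_mem (rels := gradingRelations C)
    ⟨⟨X, hX⟩, ⟨Y, hY⟩, ⟨Z, hZ⟩, h, rfl⟩).symm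

theorem degree_unit (h : Simple (𝟙_ C)) : degree (𝟙_ C) h = 1 :=
  mul_eq_left.1 (degree_eq_mul h h h (occurs_of_iso (λ_ (𝟙_ C)).symm)).symm

variable [IsSemisimpleTensor C]

theorem degree_congr {X Y : C} (hX : Simple X) (hY : Simple Y) (e : X ≅ Y) :
    degree X hX = degree Y hY := by
  rw [degree_eq_mul hY inferInstance hX (occurs_of_iso (e ≪≫ (ρ_ Y).symm)), degree_unit, mul_one]

theorem degree_eq_of_occurs {X Y : C} (hX : Simple X) (hY : Simple Y) (h : Occurs X Y) :
    degree X hX = degree Y hY :=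
  degree_congr hX hY h.nonempty_iso.some

theorem component_degree {X : C} (hX : Simple X) : component (degree X hX) X :=
  fun _ hZ h => degree_eq_of_occurs hZ hX h

theorem component_iff_degree_eq {X : C} (hX : Simple X) {g : UniversalGradingGroup C} :
    component g X ↔ degree X hX = g :=
  ⟨fun h => h X hX (occurs_refl X), fun h => h ▸ component_degree hX⟩

theorem degree_mul_degree_eq_one {X Y : C} (hX : Simple X) (hY : Simple Y)
    (h : Occurs (𝟙_ C) (X ⊗ Y)) : degree X hX * degree Y hY = 1 := by
  rw [← degree_eq_mul hX hY inferInstance h, degree_unit]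

variable [MonoidalPreadditive C] [RigidCategory C]

theorem degree_rightDual {X : C} (hX : Simple X) (hX' : Simple Xᘁ) :
    degree Xᘁ hX' = (degree X hX)⁻¹ :=
  (inv_eq_of_mul_eq_one_right <| degree_mul_degree_eq_one hX hX'
    (unit_occurs_tensor_rightDual (Simple.not_isZero X))).symm

/-- The universal grading is faithful. -/
theorem exists_degree_eq (g : UniversalGradingGroup C) :
    ∃ (X : C) (hX : Simple X), degree X hX = g := by
  obtain ⟨w, rfl⟩ := PresentedGroup.mk_surjective _ g
  induction w using FreeGroup.induction_on with
  | C1 => exact ⟨𝟙_ C, inferInstance, degree_unit _⟩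
  | of X => exact ⟨X.1, X.2, rfl⟩
  | inv_of X _ =>
    have := X.2
    exact ⟨(X.1)ᘁ, simple_rightDual _, by rw [degree_rightDual X.2]; rfl⟩
  | mul x y hx hy =>
    obtain ⟨X, hX, hx⟩ := hx
    obtain ⟨Y, hY, hy⟩ := hy
    obtain ⟨Z, hZ, hZXY⟩ :=
      exists_occurs (not_isZero_tensor (Simple.not_isZero X) (Simple.not_isZero Y))
    exact ⟨Z, hZ, by rw [degree_eq_mul hX hY hZ hZXY, hx, hy, map_mul]⟩

/-- The fusion subcategory of all objects whose simple constituents have degree in `H`. -/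
def FusionSubcategory.ofSubgroup (H : Subgroup (UniversalGradingGroup C)) :
    FusionSubcategory C where
  obj X := ∀ (Z : C) (hZ : Simple Z), Occurs Z X → degree Z hZ ∈ H
  unit Z hZ h := by
    rw [degree_eq_of_occurs hZ inferInstance h, degree_unit]
    exact H.one_mem
  tensor hX hY Z hZ h := by
    obtain ⟨X', hX', hXX', h⟩ := h.exists_left
    obtain ⟨Y', hY', hYY', h⟩ := h.exists_right
    rw [degree_eq_mul hX' hY' hZ h]
    exact H.mul_mem (hX _ _ hXX') (hY _ _ hYY')
  rightDual hX Z hZ h := by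
    obtain ⟨X', hX', hXX', h⟩ := (occurs_rightDual_iff.1 h).exists_right
    rw [eq_inv_of_mul_eq_one_left (degree_mul_degree_eq_one hZ hX' h)]
    exact H.inv_mem (hX _ _ hXX')
  leftDual hX Z hZ h := by
    obtain ⟨X', hX', hXX', h⟩ := (occurs_leftDual_iff.1 h).exists_left
    rw [eq_inv_of_mul_eq_one_right (degree_mul_degree_eq_one hX' hZ h)]
    exact H.inv_mem (hX _ _ hXX')
  biprod hX hY Z hZ h := h.biprod.elim (hX Z hZ) (hY Z hZ)
  retract r hY Z hZ h := hY Z hZ (h.of_retract r)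

theorem FusionSubcategory.ofSubgroup_obj_iff {H : Subgroup (UniversalGradingGroup C)} {X : C}
    (hX : Simple X) : (ofSubgroup H).obj X ↔ degree X hX ∈ H :=
  ⟨fun h => h X hX (occurs_refl X), fun h _ hZ hZX => degree_eq_of_occurs hZ hX hZX ▸ h⟩

theorem adjointSubcategory_le_ofSubgroup (H : Subgroup (UniversalGradingGroup C)) :
    (adjointSubcategory C).obj ≤ (FusionSubcategory.ofSubgroup H).obj := by
  intro A hA
  refine hA _ ?_
  rintro Z ⟨hZ, Y, hY, hZY⟩
  have := simple_rightDual Y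
  rw [FusionSubcategory.ofSubgroup_obj_iff hZ, degree_eq_mul hY this hZ hZY, degree_rightDual hY,
    mul_inv_cancel]
  exact H.one_mem

/-- The trivial component of the universal grading is the adjoint subcategory. For a generalized
near-group category with non-pointed adjoint subcategory `A`, the cosets `g ⊗ A` define a grading of
`C` by a quotient of the group of invertible objects, and its trivial component is `A`. The
universal group maps to that quotient. -/
theorem degree_eq_one_iff (hC : IsGeneralizedNearGroup C)
    (hA : (adjointSubcategory C).IsNonPointed) {X : C} (hX : Simple X) :
    degree X hX = 1 ↔ (adjointSubcategory C).obj X := by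
  constructor
  · intro h
    have := normal_invertibles_adjointSubcategory hC hA
    choose γ hγ using fun Y : {Y : C // Simple Y} =>
      have := Y.2
      exists_mem_inv_mul hC hA Y.1
    let φ : {Y : C // Simple Y} → (Skeleton C)ˣ ⧸ (adjointSubcategory C).invertibles :=
      fun Y => QuotientGroup.mk (γ Y)
    have hφ : ∀ r ∈ gradingRelations C, FreeGroup.lift φ r = 1 := by
      rintro _ ⟨X, Y, Z, hZ, rfl⟩
      have := Z.2
      rw [map_mul, map_mul, map_inv, FreeGroup.lift_apply_of, FreeGroup.lift_apply_of,
        FreeGroup.lift_apply_of, mul_inv_eq_one]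
      exact QuotientGroup.eq.2 (inv_mul_mem_invertibles
        (adjointSubcategory_mem_inv_mul_of_occurs hC hA hZ (hγ X) (hγ Y)) (hγ Z))
    have h1 : φ ⟨X, hX⟩ = 1 := by
      have := congrArg (PresentedGroup.toGroup hφ) h
      rwa [degree, PresentedGroup.toGroup.of, map_one] at this
    have h2 := (adjointSubcategory C).mem_mul ((QuotientGroup.eq_one_iff _).1 h1) (hγ ⟨X, hX⟩)
    rwa [Units.mul_inv_cancel_left, FusionSubcategory.mem_toSkeleton] at h2
  · intro h
    simpa using (FusionSubcategory.ofSubgroup_obj_iff hX).1 (adjointSubcategory_le_ofSubgroup ⊥ _ h)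

end Degree

/-! ### The correspondence between non-pointed fusion subcategories and subgroups -/

section Correspondence

variable [IsSemisimpleTensor C] [MonoidalPreadditive C] [RigidCategory C]

/-- The subgroup of the universal grading group formed by the degrees of the simple objects of a
fusion subcategory. -/
def FusionSubcategory.degrees (D : FusionSubcategory C) : Subgroup (UniversalGradingGroup C) where
  carrier := {g | ∃ (X : C) (hX : Simple X), D.obj X ∧ degree X hX = g}
  one_mem' := ⟨𝟙_ C, inferInstance, D.unit, degree_unit _⟩
  mul_mem' := by
    rintro _ _ ⟨X, hX, hXD, rfl⟩ ⟨Y, hY, hYD, rfl⟩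
    obtain ⟨Z, hZ, hZXY⟩ :=
      exists_occurs (not_isZero_tensor (Simple.not_isZero X) (Simple.not_isZero Y))
    exact ⟨Z, hZ, D.obj_of_occurs hZXY (D.tensor hXD hYD), degree_eq_mul hX hY hZ hZXY⟩
  inv_mem' := by
    rintro _ ⟨X, hX, hXD, rfl⟩
    exact ⟨Xᘁ, simple_rightDual X, D.rightDual hXD, degree_rightDual hX _⟩

theorem FusionSubcategory.mem_degrees_iff {D : FusionSubcategory C}
    {g : UniversalGradingGroup C} :
    g ∈ D.degrees ↔ ∃ Y : C, ¬ IsZero Y ∧ D.obj Y ∧ component g Y := by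
  constructor
  · rintro ⟨X, hX, hXD, rfl⟩
    exact ⟨X, Simple.not_isZero X, hXD, component_degree hX⟩
  · rintro ⟨Y, hY, hYD, hYg⟩
    obtain ⟨X, hX, hXY⟩ := exists_occurs hY
    exact ⟨X, hX, D.obj_of_occurs hXY hYD, hYg X hX hXY⟩

theorem FusionSubcategory.degrees_ofSubgroup (H : Subgroup (UniversalGradingGroup C)) :
    (ofSubgroup H).degrees = H := by
  ext g
  constructor
  · rintro ⟨X, hX, hXH, rfl⟩
    exact (ofSubgroup_obj_iff hX).1 hXH
  · intro hg
    obtain ⟨X, hX, rfl⟩ := exists_degree_eq g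
    exact ⟨X, hX, (ofSubgroup_obj_iff hX).2 hg, rfl⟩

/-- If `Z` has the degree of an object `Y` of `D`, then `Z ⊗ Y*` has degree `1`, hence belongs to
the adjoint subcategory and so to `D`; and `Z` is a constituent of `(Z ⊗ Y*) ⊗ Y`. -/
theorem FusionSubcategory.ofSubgroup_degrees (hC : IsGeneralizedNearGroup C)
    (hA : (adjointSubcategory C).IsNonPointed) {D : FusionSubcategory C} (hD : D.IsNonPointed) :
    ofSubgroup D.degrees = D := by
  refine FusionSubcategory.ext (funext fun X => propext ⟨fun h => ?_, fun h Z hZ hZX =>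
    ⟨Z, hZ, D.obj_of_occurs hZX h, rfl⟩⟩)
  refine D.obj_of_forall_occurs fun Z hZ hZX => ?_
  obtain ⟨Y, hY, hYD, hYZ⟩ := h Z hZ hZX
  have hY' := simple_rightDual Y
  have hZY : D.obj (Z ⊗ Yᘁ) := D.obj_of_forall_occurs fun W hW hWZY => by
    refine adjointSubcategory_le hC hD _ ((degree_eq_one_iff hC hA hW).1 ?_)
    rw [degree_eq_mul hZ hY' hW hWZY, degree_rightDual hY, hYZ, mul_inv_cancel]
  have h1 : Occurs (𝟙_ C) (Yᘁ ⊗ Y) := occurs_rightDual_iff.1 (occurs_refl _)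
  have h2 : Occurs Z ((Z ⊗ Yᘁ) ⊗ Y) :=
    ((h1.tensorLeft (Simple.not_isZero Z)).of_iso_left (ρ_ Z)).of_iso (α_ Z Yᘁ Y).symm
  exact D.obj_of_occurs h2 (D.tensor hZY hYD)

theorem FusionSubcategory.ofSubgroup_isNonPointed (hA : (adjointSubcategory C).IsNonPointed)
    (H : Subgroup (UniversalGradingGroup C)) : (ofSubgroup H).IsNonPointed := by
  obtain ⟨X, hX, hXA, hXinv⟩ := hA
  exact ⟨X, hX, adjointSubcategory_le_ofSubgroup H X hXA, hXinv⟩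

/-- Non-pointed fusion subcategories correspond to subgroups of the universal grading group. -/
def nonPointedEquivSubgroup (hC : IsGeneralizedNearGroup C)
    (hA : (adjointSubcategory C).IsNonPointed) :
    {D : FusionSubcategory C // D.IsNonPointed} ≃ Subgroup (UniversalGradingGroup C) where
  toFun D := D.1.degrees
  invFun H := ⟨.ofSubgroup H, FusionSubcategory.ofSubgroup_isNonPointed hA H⟩
  left_inv D := Subtype.ext (FusionSubcategory.ofSubgroup_degrees hC hA D.2)
  right_inv H := FusionSubcategory.degrees_ofSubgroup H

/-! ### Components of the universal grading -/

theorem exists_isInvertible_component (hC : IsGeneralizedNearGroup C)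
    (hA : (adjointSubcategory C).IsNonPointed) (g : UniversalGradingGroup C) :
    ∃ δ : C, Simple δ ∧ IsInvertible δ ∧ component g δ := by
  obtain ⟨Y, hY, rfl⟩ := exists_degree_eq g
  by_cases hYinv : IsInvertible Y
  · exact ⟨Y, hY, hYinv, component_degree hY⟩
  obtain ⟨X, hX, hXA, hXinv⟩ := hA
  obtain ⟨δ, hδ, hδinv, ⟨e⟩⟩ := hC X Y hX hXinv hY hYinv
  refine ⟨δ, hδ, hδinv, (component_iff_degree_eq hδ).2 ?_⟩
  rw [degree_eq_mul hδ hX hY (occurs_of_iso e.symm),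
    (degree_eq_one_iff hC ⟨X, hX, hXA, hXinv⟩ hX).2 hXA, mul_one]

theorem isIrrList_component (hC : IsGeneralizedNearGroup C)
    (hA : (adjointSubcategory C).IsNonPointed) {g : UniversalGradingGroup C} {δ : C}
    (hδ : Simple δ) (hδinv : IsInvertible δ) (hδg : component g δ) {s : ℕ} {A : Fin s → C}
    (hAs : IsIrrList (adjointSubcategory C).obj A) : IsIrrList (component g) fun i => δ ⊗ A i := by
  have hu := isInvertible_iff_isUnit.1 hδinv
  obtain ⟨V, hδV, hVδ⟩ := exists_toSkeleton_mul_eq_one hu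
  have hs : ∀ i, Simple (δ ⊗ A i) := fun i =>
    have := hAs.simple i
    simple_tensor_of_isUnit hu _
  rw [component_iff_degree_eq hδ] at hδg
  refine ⟨hs, fun i => ?_, fun i j h => ?_, fun Y hY hYg => ?_⟩
  · rw [component_iff_degree_eq (hs i), degree_eq_mul hδ (hAs.simple i) (hs i)
      (have := hs i; occurs_refl _), (degree_eq_one_iff hC hA (hAs.simple i)).2 (hAs.mem i), hδg,
      mul_one]
  · refine hAs.injective i j (toSkeleton_eq_toSkeleton_iff.1 (hu.mul_left_cancel ?_))
    rw [← Skeleton.toSkeleton_tensorObj, ← Skeleton.toSkeleton_tensorObj]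
    exact toSkeleton_eq_toSkeleton_iff.2 h
  · rw [component_iff_degree_eq hY] at hYg
    have hVY : Simple (V ⊗ Y) := simple_tensor_of_isUnit (isUnit_iff_exists.2 ⟨_, hVδ, hδV⟩) Y
    have he : toSkeleton Y = toSkeleton (δ ⊗ (V ⊗ Y)) := by
      rw [Skeleton.toSkeleton_tensorObj, Skeleton.toSkeleton_tensorObj, ← mul_assoc, hδV, one_mul]
    obtain ⟨e⟩ := toSkeleton_eq_toSkeleton_iff.1 he
    have hdeg : degree (V ⊗ Y) hVY = 1 := by
      have := degree_eq_mul hδ hVY hY (occurs_of_iso e)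
      rwa [hYg, hδg, left_eq_mul] at this
    obtain ⟨i, ⟨e'⟩⟩ := hAs.exhaustive _ hVY ((degree_eq_one_iff hC hA hVY).1 hdeg)
    exact ⟨i, ⟨e ≪≫ whiskerLeftIso δ e'⟩⟩

end Correspondence

end FusionCat

theorem proposition3p6 {k : Type*} [Field k] [IsAlgClosed k] [CharZero k]
    {C : Type*} [Category C] [Abelian C] [Linear k C] [MonoidalCategory C]
    [MonoidalPreadditive C] [MonoidalLinear k C] [RigidCategory C] [IsFusionCategory k C]
    (hC : IsGeneralizedNearGroup C)
    {n : ℕ} (X : Fin (n + 1) → C) (hX : IsIrrList (fun Y : C => ¬ IsInvertible Y) X)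
    (hk : multiplicity k X ≠ 0) :
    (adjointSubcategory C).IsNonPointed ∧
    (∃ e : {D : FusionSubcategory C // D.IsNonPointed} ≃ Subgroup (UniversalGradingGroup C),
      ∀ (D : {D : FusionSubcategory C // D.IsNonPointed}) (g : UniversalGradingGroup C),
        g ∈ e D ↔ ∃ Y : C, ¬ IsZero Y ∧ D.1.obj Y ∧ component g Y) ∧
    (∀ g : UniversalGradingGroup C, ∃ δ : C, Simple δ ∧ IsInvertible δ ∧ component g δ) ∧
    (∀ (g : UniversalGradingGroup C) (δ : C), Simple δ → IsInvertible δ → component g δ →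
      ∀ {s : ℕ} (A : Fin s → C), IsIrrList (adjointSubcategory C).obj A →
        IsIrrList (component g) fun i => δ ⊗ A i) := by
  have : IsSemisimpleTensor C := IsFusionCategory.isSemisimpleTensor k
  have hA : (adjointSubcategory C).IsNonPointed := by
    obtain ⟨i, hi⟩ := Function.ne_iff.1 hk
    have : Nontrivial (X i ⟶ X 0 ⊗ (X 0)ᘁ) := by
      by_contra h
      rw [not_nontrivial_iff_subsingleton] at h
      exact hi (Module.finrank_zero_of_subsingleton)
    exact ⟨X i, hX.simple i, fun D hD => hD _ ⟨hX.simple i, X 0, hX.simple 0, exists_ne 0⟩,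
      hX.mem i⟩
  exact ⟨hA, ⟨nonPointedEquivSubgroup hC hA, fun _ _ => FusionSubcategory.mem_degrees_iff⟩,
    exists_isInvertible_component hC hA,
    fun _ _ hδ hδinv hδg _ _ hAs => isIrrList_component hC hA hδ hδinv hδg hAs⟩
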